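/- Let $\Sigma$ be a smooth three-manifold. A Cauchy pair $(\mathfrak{e},\Theta)$ on $\Sigma$ consists of a smooth coframe $\mathfrak{e}=(e_u,e_l,e_n)$ (three one-forms, linearly independent at every point) and a smooth symmetric covariant two-tensor $\Theta$. Let $h = e_u\otimes e_u+e_l\otimes e_l+e_n\otimes e_n$ be the associated Riemannian metric, and for a one-form $\alpha$ write $\Theta(\alpha)=\Theta(\alpha^{\sharp},\cdot)$, where $\alpha^\sharp$ is the $h$-dual vector field. The pair $(\mathfrak{e},\Theta)$ is called parallel if $$\mathrm{d}e_a=\Theta(e_a)\wedge e_u\quad (a=u,l,n),\qquad [\Theta(e_u)]=0\in H^1(\Sigma,\mathbb{R}),$$ the last condition meaning that $\Theta(e_u)$ is exact. Proposition. Let $(\mathfrak{e},\Theta)$ be a parallel Cauchy pair on $\Sigma$. Then the Hamiltonian constraint $$\mathrm{R}_h=|\Theta|_h^2-(\mathrm{Tr}_h\Theta)^2$$ holds on $\Sigma$ if and only if the momentum constraint $$\mathrm{d}\,\mathrm{Tr}_h(\Theta)=\mathrm{div}_h(\Theta)$$ holds on $\Sigma$. Here $\mathrm{R}_h$ is the scalar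 curvature of $h$, and $\mathrm{div}_h(\Theta)(Z)=\sum_a(\nabla^h_{E_a}\Theta)(E_a,Z)$ for an $h$-orthonormal frame $(E_a)$ and the Levi-Civita connection $\nabla^h$. -/

import Mathlib

open scoped Manifold ContDiff Bundle

noncomputable section

namespace ParallelCauchy

/-- Vector fields on a three-manifold, with no regularity imposed. -/
abbrev VField (M : Type*) [TopologicalSpace M] [ChartedSpace (EuclideanSpace ℝ (Fin 3)) M] :
    Type _ :=
  (x : M) → TangentSpace (𝓡 3) x

/-- One-forms on a three-manifold, with no regularity imposed. -/
abbrev OneForm (M : Type*) [TopologicalSpace M] [ChartedSpace (EuclideanSpace ℝ (Fin 3)) M] :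
    Type _ :=
  (x : M) → TangentSpace (𝓡 3) x →L[ℝ] ℝ

/-- Covariant two-tensors on a three-manifold, with no regularity imposed. -/
abbrev TwoTensor (M : Type*) [TopologicalSpace M] [ChartedSpace (EuclideanSpace ℝ (Fin 3)) M] :
    Type _ :=
  (x : M) → TangentSpace (𝓡 3) x →L[ℝ] TangentSpace (𝓡 3) x →L[ℝ] ℝ

section Calculus

variable {M : Type*} [TopologicalSpace M] [ChartedSpace (EuclideanSpace ℝ (Fin 3)) M]

/-- Smoothness of a vector field, as a section of the tangent bundle. -/
def SmoothField [IsManifold (𝓡 3) ∞ M] (X : VField M) : Prop :=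
  ContMDiff (𝓡 3) ((𝓡 3).prod 𝓘(ℝ, EuclideanSpace ℝ (Fin 3))) ∞
    (fun x => Bundle.TotalSpace.mk' (EuclideanSpace ℝ (Fin 3))
      (E := fun y : M => TangentSpace (𝓡 3) y) x (X x))

/-- Smoothness of a one-form, as a section of the cotangent bundle. -/
def SmoothForm [IsManifold (𝓡 3) ∞ M] (α : OneForm M) : Prop :=
  ContMDiff (𝓡 3) ((𝓡 3).prod 𝓘(ℝ, EuclideanSpace ℝ (Fin 3) →L[ℝ] ℝ)) ∞
    (fun x => Bundle.TotalSpace.mk' (EuclideanSpace ℝ (Fin 3) →L[ℝ] ℝ)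
      (E := fun y : M => TangentSpace (𝓡 3) y →L[ℝ] Bundle.Trivial M ℝ y) x (α x))

/-- Smoothness of a covariant two-tensor, as a section of the bundle of bilinear forms. -/
def SmoothTensor [IsManifold (𝓡 3) ∞ M] (T : TwoTensor M) : Prop :=
  ContMDiff (𝓡 3)
    ((𝓡 3).prod 𝓘(ℝ, EuclideanSpace ℝ (Fin 3) →L[ℝ] EuclideanSpace ℝ (Fin 3) →L[ℝ] ℝ)) ∞
    (fun x => Bundle.TotalSpace.mk'
      (EuclideanSpace ℝ (Fin 3) →L[ℝ] EuclideanSpace ℝ (Fin 3) →L[ℝ] ℝ)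
      (E := fun y : M => TangentSpace (𝓡 3) y →L[ℝ] TangentSpace (𝓡 3) y →L[ℝ]
        Bundle.Trivial M ℝ y) x (T x))

/-- The derivative `X(f) = df(X)` of a function `f` along a vector field `X`. -/
def dirDeriv (X : VField M) (f : M → ℝ) (x : M) : ℝ :=
  mvfderiv (𝓡 3) f x (X x)

/-- The exterior derivative of a one-form evaluated on two vector fields:
`dα(X, Y) = X(α(Y)) - Y(α(X)) - α([X, Y])`. -/
def extDerivForm (α : OneForm M) (X Y : VField M) (x : M) : ℝ :=
  dirDeriv X (fun y => α y (Y y)) x - dirDeriv Y (fun y => α y (X y)) x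
    - α x (VectorField.mlieBracket (𝓡 3) X Y x)

/-- The wedge product of two one-forms evaluated on two vector fields:
`(α ∧ β)(X, Y) = α(X) β(Y) - α(Y) β(X)`. -/
def wedge (α β : OneForm M) (X Y : VField M) (x : M) : ℝ :=
  α x (X x) * β x (Y x) - α x (Y x) * β x (X x)

/-- A one-form is exact, that is, closed with vanishing class in `H¹(M, ℝ)`,
if it is the differential of a smooth function. -/
def IsExactForm (α : OneForm M) : Prop :=
  ∃ f : M → ℝ, ContMDiff (𝓡 3) 𝓘(ℝ, ℝ) ∞ f ∧ ∀ x, mvfderiv (𝓡 3) f x = α x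

end Calculus

/-- A smooth coframe `(e_u, e_l, e_n)` on a three-manifold: three smooth one-forms, pointwise
linearly independent. The indices `0, 1, 2` stand for `u, l, n`. -/
structure Coframe (M : Type*) [TopologicalSpace M] [ChartedSpace (EuclideanSpace ℝ (Fin 3)) M]
    [IsManifold (𝓡 3) ∞ M] where
  form : Fin 3 → OneForm M
  smooth : ∀ a, SmoothForm (form a)
  linearIndependent : ∀ x, LinearIndependent ℝ (fun a => form a x)

/-- A shape operator: a smooth symmetric covariant two-tensor. -/
structure ShapeOperator (M : Type*) [TopologicalSpace M]
    [ChartedSpace (EuclideanSpace ℝ (Fin 3)) M] [IsManifold (𝓡 3) ∞ M] where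
  tensor : TwoTensor M
  smooth : SmoothTensor tensor
  symm : ∀ x v w, tensor x v w = tensor x w v

namespace Coframe

variable {M : Type*} [TopologicalSpace M] [ChartedSpace (EuclideanSpace ℝ (Fin 3)) M]
  [IsManifold (𝓡 3) ∞ M] (e : Coframe M)

theorem bijective_pi (x : M) :
    Function.Bijective (LinearMap.pi fun a => (e.form a x : TangentSpace (𝓡 3) x →ₗ[ℝ] ℝ)) := by
  have hdim : Module.finrank ℝ (TangentSpace (𝓡 3) x) = 3 :=
    finrank_euclideanSpace_fin (𝕜 := ℝ) (n := 3)
  have : FiniteDimensional ℝ (TangentSpace (𝓡 3) x) :=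
    inferInstanceAs (FiniteDimensional ℝ (EuclideanSpace ℝ (Fin 3)))
  have hli : LinearIndependent ℝ
      (fun a => (e.form a x : TangentSpace (𝓡 3) x →ₗ[ℝ] ℝ)) :=
    (e.linearIndependent x).map' (ContinuousLinearMap.coeLM ℝ)
      (LinearMap.ker_eq_bot.2 ContinuousLinearMap.coe_injective)
  have hspan : Submodule.span ℝ
      (Set.range fun a => (e.form a x : TangentSpace (𝓡 3) x →ₗ[ℝ] ℝ)) = ⊤ := by
    apply hli.span_eq_top_of_card_eq_finrank'
    rw [Fintype.card_fin]
    exact (Subspace.dual_finrank_eq.trans hdim).symm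
  have hinj : Function.Injective
      (LinearMap.pi fun a => (e.form a x : TangentSpace (𝓡 3) x →ₗ[ℝ] ℝ)) := by
    rw [← LinearMap.ker_eq_bot, LinearMap.ker_eq_bot']
    intro v hv
    rw [← Module.forall_dual_apply_eq_zero_iff ℝ v]
    intro φ
    have hφ : φ ∈ Submodule.span ℝ
        (Set.range fun a => (e.form a x : TangentSpace (𝓡 3) x →ₗ[ℝ] ℝ)) := by
      rw [hspan]; trivial
    induction hφ using Submodule.span_induction with
    | mem ψ hψ =>
      obtain ⟨a, rfl⟩ := hψ
      exact congrFun hv a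
    | zero => rfl
    | add ψ χ _ _ h₁ h₂ => simp [h₁, h₂]
    | smul c ψ _ h₁ => simp [h₁]
  refine ⟨hinj, (LinearMap.injective_iff_surjective_of_finrank_eq_finrank ?_).1 hinj⟩
  rw [hdim, Module.finrank_fin_fun]

/-- The coordinates of tangent vectors at `x` with respect to the coframe. -/
def coordEquiv (x : M) : TangentSpace (𝓡 3) x ≃ₗ[ℝ] (Fin 3 → ℝ) :=
  LinearEquiv.ofBijective _ (e.bijective_pi x)

/-- The frame dual to the coframe: `e_b (frame a) = δ_{ab}`. -/
def frame (a : Fin 3) : VField M :=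
  fun x => (e.coordEquiv x).symm (Pi.single a 1)

theorem form_frame (a b : Fin 3) (x : M) : e.form b x (e.frame a x) = if b = a then 1 else 0 := by
  have h := congrFun ((e.coordEquiv x).apply_symm_apply (Pi.single a 1)) b
  rw [Pi.single_apply] at h
  exact h

/-- The Riemannian metric `h = e_u ⊗ e_u + e_l ⊗ e_l + e_n ⊗ e_n`. The frame dual to the coframe
is orthonormal for it. -/
def metric (X Y : VField M) (x : M) : ℝ :=
  ∑ a, e.form a x (X x) * e.form a x (Y x)

/-- The vector field dual to a one-form with respect to the metric:
`α♯ = ∑ₐ α(Eₐ) Eₐ` for the orthonormal frame `E`. -/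
def sharp (α : OneForm M) : VField M :=
  fun x => ∑ a, α x (e.frame a x) • e.frame a x

/-- The one-form `Θ(α) = Θ(α♯, ·)`. -/
def apply (Θ : ShapeOperator M) (α : OneForm M) : OneForm M :=
  fun x => Θ.tensor x (e.sharp α x)

/-- The right-hand side of the Koszul formula for `h(∇_X Y, Z)`. -/
def koszul (X Y Z : VField M) (x : M) : ℝ :=
  (1 / 2) * (dirDeriv X (e.metric Y Z) x + dirDeriv Y (e.metric X Z) x
    - dirDeriv Z (e.metric X Y) x
    + e.metric (VectorField.mlieBracket (𝓡 3) X Y) Z x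
    - e.metric (VectorField.mlieBracket (𝓡 3) X Z) Y x
    - e.metric (VectorField.mlieBracket (𝓡 3) Y Z) X x)

/-- The Levi-Civita connection `∇_X Y` of the metric `h`, given by the Koszul formula
for `h(∇_X Y, Eₐ)` in the orthonormal frame `E`. -/
def nabla (X Y : VField M) : VField M :=
  fun x => ∑ a, e.koszul X Y (e.frame a) x • e.frame a x

/-- The curvature `R(X, Y)Z = ∇_X ∇_Y Z - ∇_Y ∇_X Z - ∇_[X, Y] Z`. -/
def riemann (X Y Z : VField M) : VField M :=
  e.nabla X (e.nabla Y Z) - e.nabla Y (e.nabla X Z)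
    - e.nabla (VectorField.mlieBracket (𝓡 3) X Y) Z

/-- The Ricci curvature `Ric(Y, Z) = ∑ₐ h(R(Eₐ, Y)Z, Eₐ)`, the trace of `X ↦ R(X, Y)Z`. -/
def ricci (Y Z : VField M) (x : M) : ℝ :=
  ∑ a, e.metric (e.riemann (e.frame a) Y Z) (e.frame a) x

/-- The scalar curvature, the metric trace of the Ricci curvature. -/
def scalarCurvature (x : M) : ℝ :=
  ∑ a, e.ricci (e.frame a) (e.frame a) x

/-- The metric trace of `Θ`. -/
def trace (Θ : ShapeOperator M) (x : M) : ℝ :=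
  ∑ a, Θ.tensor x (e.frame a x) (e.frame a x)

/-- The squared norm of `Θ` as a two-tensor. -/
def normSq (Θ : ShapeOperator M) (x : M) : ℝ :=
  ∑ a, ∑ b, Θ.tensor x (e.frame a x) (e.frame b x) ^ 2

/-- The covariant derivative
`(∇_X Θ)(Y, Z) = X(Θ(Y, Z)) - Θ(∇_X Y, Z) - Θ(Y, ∇_X Z)`. -/
def nablaTensor (Θ : ShapeOperator M) (X Y Z : VField M) (x : M) : ℝ :=
  dirDeriv X (fun y => Θ.tensor y (Y y) (Z y)) x
    - Θ.tensor x (e.nabla X Y x) (Z x) - Θ.tensor x (Y x) (e.nabla X Z x)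

/-- The divergence `div(Θ)(Z) = ∑ₐ (∇_{Eₐ} Θ)(Eₐ, Z)`. -/
def div (Θ : ShapeOperator M) (Z : VField M) (x : M) : ℝ :=
  ∑ a, e.nablaTensor Θ (e.frame a) (e.frame a) Z x

end Coframe

section Pairs

variable {M : Type*} [TopologicalSpace M] [ChartedSpace (EuclideanSpace ℝ (Fin 3)) M]
  [IsManifold (𝓡 3) ∞ M]

/-- A Cauchy pair `(e, Θ)` is parallel if `d e_a = Θ(e_a) ∧ e_u` for `a = u, l, n`, and
`[Θ(e_u)] = 0` in `H¹(M, ℝ)`. -/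
structure IsParallelCauchyPair (e : Coframe M) (Θ : ShapeOperator M) : Prop where
  extDeriv_eq : ∀ (a : Fin 3) (X Y : VField M), SmoothField X → SmoothField Y → ∀ x,
    extDerivForm (e.form a) X Y x = wedge (e.apply Θ (e.form a)) (e.form 0) X Y x
  exact_apply : IsExactForm (e.apply Θ (e.form 0))

/-- The Hamiltonian constraint `R_h = |Θ|² - (Tr Θ)²`. -/
def HamiltonianConstraint (e : Coframe M) (Θ : ShapeOperator M) : Prop :=
  ∀ x, e.scalarCurvature x = e.normSq Θ x - e.trace Θ x ^ 2

/-- The momentum constraint `d Tr Θ = div Θ`, an equality of one-forms. -/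
def MomentumConstraint (e : Coframe M) (Θ : ShapeOperator M) : Prop :=
  ∀ Z : VField M, SmoothField Z → ∀ x, dirDeriv Z (e.trace Θ) x = e.div Θ Z x

end Pairs

end ParallelCauchy

end

/-!
Let `E_a` be the frame dual to the coframe. For a parallel Cauchy pair the first structure equation
can be solved explicitly: the Levi-Civita connection forms are `Γ_bc = δ_c0 Θ(e_b) - δ_b0 Θ(e_c)`.
Let `C(X, Y; Z) = (∇_X Θ)(Y, Z) - (∇_Y Θ)(X, Z)` be the Codazzi defect. On the frame it is
`C(X, Y; E_a) = (d Θ(e_a) - Θ(e_a) ∧ Θ(e_u))(X, Y)`, and tracing it gives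
`d Tr Θ (X) - div Θ (X) = ∑ₐ C(X, E_a; E_a)`.

Exactness of `Θ(e_u)` gives `C(·, ·; E_u) = 0`, and `d (d e_a) = 0` gives `C(E_l, E_n; ·) = 0`. So
the momentum constraint only has content along `E_u`. On the other hand the second structure
equation gives `R_h = |Θ|² - (Tr Θ)² + 2 ∑ₐ C(E_u, E_a; E_a)`, whose last term vanishes exactly
when the momentum constraint holds along `E_u`.
-/

namespace ParallelCauchy

section Manifold

variable {𝕜 E H M : Type*} [NontriviallyNormedField 𝕜] [NormedAddCommGroup E] [NormedSpace 𝕜 E]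
  [TopologicalSpace H] {I : ModelWithCorners 𝕜 E H} [TopologicalSpace M] [ChartedSpace H M]

section VectorBundle

variable {F F' ι : Type*} [NormedAddCommGroup F] [NormedSpace 𝕜 F]
  [NormedAddCommGroup F'] [NormedSpace 𝕜 F'] {V : M → Type*}
  [TopologicalSpace (Bundle.TotalSpace F V)] [∀ x, TopologicalSpace (V x)]
  [∀ x, AddCommGroup (V x)] [∀ x, Module 𝕜 (V x)] [FiberBundle F V] [VectorBundle 𝕜 F V]
  {n : WithTop ℕ∞} {x : M}

theorem contMDiffAt_section_clm_trivial_iff {φ : (x : M) → V x →L[𝕜] F'} :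
    ContMDiffAt I (I.prod 𝓘(𝕜, F →L[𝕜] F')) n
      (fun y => Bundle.TotalSpace.mk' (F →L[𝕜] F')
        (E := fun y => V y →L[𝕜] Bundle.Trivial M F' y) y (φ y)) x ↔
    CMDiffAt n (fun y => φ y ∘L (trivializationAt F V x).symmL 𝕜 y) x := by
  simp only [Bundle.contMDiffAt_section, hom_trivializationAt_apply,
    ContinuousLinearMap.inCoordinates, Bundle.Trivial.fiberBundle_trivializationAt',
    Bundle.Trivial.continuousLinearMapAt_trivialization, ContinuousLinearMap.id_comp]

/-- In a local trivialization, `s` is obtained from `φ s` by inverting a smooth family of linear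
maps, and inversion of linear maps is smooth. -/
theorem contMDiffAt_section_of_isInvertible [CompleteSpace F] {φ : (x : M) → V x →L[𝕜] F'}
    {s : (x : M) → V x}
    (hφ : ContMDiffAt I (I.prod 𝓘(𝕜, F →L[𝕜] F')) n
      (fun y => Bundle.TotalSpace.mk' (F →L[𝕜] F')
        (E := fun y => V y →L[𝕜] Bundle.Trivial M F' y) y (φ y)) x)
    (hinv : (φ x).IsInvertible) (hs : CMDiffAt n (fun y => φ y (s y)) x) :
    CMDiffAt n (T% s) x := by
  let t := trivializationAt F V x
  have hxt : x ∈ t.baseSet := FiberBundle.mem_baseSet_trivializationAt' x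
  let A : M → F →L[𝕜] F' := fun y => φ y ∘L t.symmL 𝕜 y
  have hA : CMDiffAt n A x := contMDiffAt_section_clm_trivial_iff.1 hφ
  have hAx : (A x).IsInvertible := hinv.comp
    ⟨(t.continuousLinearEquivAt 𝕜 x hxt).symm,
      DFunLike.coe_injective (t.symm_continuousLinearEquivAt_eq hxt)⟩
  have hinverse : CMDiffAt n (fun y => (A y).inverse (φ y (s y))) x :=
    (hAx.contDiffAt_map_inverse.contMDiffAt.comp x hA).clm_apply hs
  obtain ⟨B, hB⟩ := hAx
  have hev : ∀ᶠ y in nhds x, (A y).IsInvertible := hA.continuousAt (hB ▸ B.nhds)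
  rw [Bundle.contMDiffAt_section]
  refine hinverse.congr_of_eventuallyEq ?_
  filter_upwards [hev, t.open_baseSet.mem_nhds hxt] with y hy hyt
  rw [eq_comm, hy.inverse_apply_eq]
  simp [A, t, hyt]

theorem contMDiffAt_section_of_coframe [CompleteSpace F] [Finite ι]
    {φ : ι → (x : M) → V x →L[𝕜] 𝕜} {s : (x : M) → V x}
    (hφ : ∀ a, ContMDiffAt I (I.prod 𝓘(𝕜, F →L[𝕜] 𝕜)) n
      (fun y => Bundle.TotalSpace.mk' (F →L[𝕜] 𝕜)
        (E := fun y => V y →L[𝕜] Bundle.Trivial M 𝕜 y) y (φ a y)) x)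
    (hinv : (ContinuousLinearMap.pi fun a => φ a x).IsInvertible)
    (hs : ∀ a, CMDiffAt n (fun y => φ a y (s y)) x) : CMDiffAt n (T% s) x := by
  classical
  have := Fintype.ofFinite ι
  refine contMDiffAt_section_of_isInvertible (φ := fun y => ContinuousLinearMap.pi fun a => φ a y)
    ?_ hinv (contMDiffAt_pi_space.2 hs)
  have hsum (y : M) :
      (ContinuousLinearMap.pi fun a => φ a y) ∘L (trivializationAt F V x).symmL 𝕜 y =
        ∑ a, ContinuousLinearMap.single 𝕜 (fun _ => 𝕜) a ∘L
          φ a y ∘L (trivializationAt F V x).symmL 𝕜 y := by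
    ext w a
    simp [Pi.single_apply]
  simp only [contMDiffAt_section_clm_trivial_iff, hsum] at hφ ⊢
  exact contMDiffAt_finsetSum fun a _ => contMDiffAt_const.clm_comp (hφ a)

end VectorBundle

theorem contMDiff_mvfderiv_apply {F : Type*} [NormedAddCommGroup F] [NormedSpace 𝕜 F]
    {m n : WithTop ℕ∞} [IsManifold I 1 M] {f : M → F} {X : (x : M) → TangentSpace I x}
    (hf : CMDiff n f) (hX : CMDiff m (T% X)) (hmn : m + 1 ≤ n) :
    CMDiff m (fun x => mvfderiv I f x (X x)) :=
  (contMDiff_snd_tangentBundle_modelSpace F 𝓘(𝕜, F)).comp ((hf.contMDiff_tangentMap hmn).comp hX)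

variable [IsRCLikeNormedField 𝕜]

instance {n : WithTop ℕ∞} [h : ENat.LEInfty n] : ENat.LEInfty (minSmoothness 𝕜 n) :=
  ⟨by simpa using h.out⟩

variable [IsManifold I ∞ M] [CompleteSpace E]
  {X Y Z : (x : M) → TangentSpace I x} {f : M → 𝕜}

theorem contMDiff_mlieBracket (hX : CMDiff ∞ (T% X)) (hY : CMDiff ∞ (T% Y)) :
    CMDiff ∞ (T% (VectorField.mlieBracket I X Y)) :=
  have : IsManifold I ((⊤ : ℕ∞) + 1) M := inferInstanceAs (IsManifold I ∞ M)
  ContDiff.mlieBracket_vectorField (m := ⊤) (n := ⊤) hX hY (by simp)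

/-- Compare the Jacobi identity for `X, Y, f Z` with that for `X, Y, Z`. -/
theorem mvfderiv_mlieBracket_smul (hX : CMDiff ∞ (T% X)) (hY : CMDiff ∞ (T% Y))
    (hZ : CMDiff ∞ (T% Z)) (hf : CMDiff ∞ f) (x : M) :
    mvfderiv I f x (VectorField.mlieBracket I X Y x) • Z x =
      (mvfderiv I (fun y => mvfderiv I f y (Y y)) x (X x) -
        mvfderiv I (fun y => mvfderiv I f y (X y)) x (Y x)) • Z x := by
  have hsmul {W Z : (x : M) → TangentSpace I x} {g : M → 𝕜} (hg : CMDiff ∞ g)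
      (hZ : CMDiff ∞ (T% Z)) : VectorField.mlieBracket I W (g • Z) =
        (fun y => mvfderiv I g y (W y)) • Z + g • VectorField.mlieBracket I W Z :=
    funext fun y => VectorField.mlieBracket_smul_right (hg.mdifferentiable (by simp) y)
      (hZ.mdifferentiable (by simp) y)
  have hadd {W Z Z' : (x : M) → TangentSpace I x} (hZ : CMDiff ∞ (T% Z)) (hZ' : CMDiff ∞ (T% Z')) :
      VectorField.mlieBracket I W (Z + Z') x =
        VectorField.mlieBracket I W Z x + VectorField.mlieBracket I W Z' x :=
    VectorField.mlieBracket_add_right (hZ.mdifferentiable (by simp) x)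
      (hZ'.mdifferentiable (by simp) x)
  have hjacobi {Z : (x : M) → TangentSpace I x} (hZ : CMDiff ∞ (T% Z)) :=
    VectorField.leibniz_identity_mlieBracket_apply ((hX x).of_le ENat.LEInfty.out)
      ((hY x).of_le ENat.LEInfty.out) ((hZ x).of_le ENat.LEInfty.out)
  have hXf := contMDiff_mvfderiv_apply hf hX le_rfl
  have hYf := contMDiff_mvfderiv_apply hf hY le_rfl
  have hXZ := contMDiff_mlieBracket hX hZ
  have hYZ := contMDiff_mlieBracket hY hZ
  have hjacobi_smul := hjacobi (hf.smul_section hZ)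
  rw [hsmul hf hZ, hsmul hf hZ, hsmul hf hZ, hadd (hYf.smul_section hZ) (hf.smul_section hYZ),
    hadd (hXf.smul_section hZ) (hf.smul_section hXZ), hsmul hYf hZ, hsmul hf hYZ, hsmul hXf hZ,
    hsmul hf hXZ] at hjacobi_smul
  simp only [Pi.add_apply, Pi.smul_apply', hjacobi hZ] at hjacobi_smul
  linear_combination (norm := module) -hjacobi_smul

end Manifold

variable {M : Type*} [TopologicalSpace M] [ChartedSpace (EuclideanSpace ℝ (Fin 3)) M]

/-- A smooth real function on a three-manifold. -/
abbrev SmoothFunction (f : M → ℝ) : Prop := ContMDiff (𝓡 3) 𝓘(ℝ, ℝ) ∞ f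

theorem SmoothFunction.mdifferentiableAt {f : M → ℝ} (hf : SmoothFunction f) (x : M) :
    MDifferentiableAt (𝓡 3) 𝓘(ℝ, ℝ) f x :=
  hf.mdifferentiable (by simp) x

section Derivative

variable {X : VField M} {f g : M → ℝ} {x : M}

theorem dirDeriv_const (X : VField M) (c : ℝ) (x : M) : dirDeriv X (fun _ => c) x = 0 := by
  simp [dirDeriv, mvfderiv_const]

theorem dirDeriv_add (hf : MDifferentiableAt (𝓡 3) 𝓘(ℝ, ℝ) f x)
    (hg : MDifferentiableAt (𝓡 3) 𝓘(ℝ, ℝ) g x) :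
    dirDeriv X (fun y => f y + g y) x = dirDeriv X f x + dirDeriv X g x := by
  simp [dirDeriv, mvfderiv_fun_add hf hg]

theorem dirDeriv_sub (hf : MDifferentiableAt (𝓡 3) 𝓘(ℝ, ℝ) f x)
    (hg : MDifferentiableAt (𝓡 3) 𝓘(ℝ, ℝ) g x) :
    dirDeriv X (fun y => f y - g y) x = dirDeriv X f x - dirDeriv X g x := by
  simp [dirDeriv, mvfderiv_fun_sub hf hg]

theorem dirDeriv_neg (X : VField M) (f : M → ℝ) (x : M) :
    dirDeriv X (fun y => -f y) x = -dirDeriv X f x := by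
  simp [dirDeriv, mvfderiv_fun_neg]

theorem dirDeriv_mul (hf : MDifferentiableAt (𝓡 3) 𝓘(ℝ, ℝ) f x)
    (hg : MDifferentiableAt (𝓡 3) 𝓘(ℝ, ℝ) g x) :
    dirDeriv X (fun y => f y * g y) x = f x * dirDeriv X g x + g x * dirDeriv X f x := by
  simp [dirDeriv, mvfderiv_fun_mul hf hg]

theorem dirDeriv_sum {ι : Type} {s : Finset ι} {f : ι → M → ℝ}
    (hf : ∀ a ∈ s, MDifferentiableAt (𝓡 3) 𝓘(ℝ, ℝ) (f a) x) :
    dirDeriv X (fun y => ∑ a ∈ s, f a y) x = ∑ a ∈ s, dirDeriv X (f a) x := by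
  classical
  induction s using Finset.induction_on with
  | empty => simp [dirDeriv_const]
  | insert a s ha ih =>
    rw [Finset.forall_mem_insert] at hf
    simp only [Finset.sum_insert ha]
    have hs : MDifferentiableAt (𝓡 3) 𝓘(ℝ, ℝ) (fun y => ∑ a ∈ s, f a y) x := by
      simpa only [Finset.sum_fn] using MDifferentiableAt.sum hf.2
    rw [dirDeriv_add hf.1 hs, ih hf.2]

theorem dirDeriv_sum_mul {ι : Type} {s : Finset ι} {f g : ι → M → ℝ}
    (hf : ∀ a ∈ s, MDifferentiableAt (𝓡 3) 𝓘(ℝ, ℝ) (f a) x)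
    (hg : ∀ a ∈ s, MDifferentiableAt (𝓡 3) 𝓘(ℝ, ℝ) (g a) x) :
    dirDeriv X (fun y => ∑ a ∈ s, f a y * g a y) x =
      ∑ a ∈ s, (f a x * dirDeriv X (g a) x + g a x * dirDeriv X (f a) x) := by
  rw [dirDeriv_sum (f := fun a y => f a y * g a y) fun a ha => (hf a ha).mul (hg a ha)]
  exact Finset.sum_congr rfl fun a ha => dirDeriv_mul (hf a ha) (hg a ha)

end Derivative

variable [IsManifold (𝓡 3) ∞ M]

section SmoothSections

variable {X Y Z : VField M} {α β : OneForm M}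

theorem SmoothForm.contMDiff_apply (hα : SmoothForm α) (hX : SmoothField X) :
    SmoothFunction (fun y => α y (X y)) := fun x =>
  (Bundle.contMDiffAt_section x).1 (ContMDiffAt.clm_bundle_apply (hα x) (hX x))

theorem SmoothTensor.contMDiff_apply {T : TwoTensor M} (hT : SmoothTensor T)
    (hX : SmoothField X) (hY : SmoothField Y) :
    SmoothFunction (fun y => T y (X y) (Y y)) := fun x =>
  (Bundle.contMDiffAt_section x).1 (ContMDiffAt.clm_bundle_apply₂ (hT x) (hX x) (hY x))

theorem SmoothTensor.smoothForm_apply {T : TwoTensor M} (hT : SmoothTensor T)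
    (hX : SmoothField X) : SmoothForm (fun y => T y (X y)) := fun x =>
  ContMDiffAt.clm_bundle_apply (hT x) (hX x)

theorem SmoothForm.zero : SmoothForm (0 : OneForm M) :=
  Bundle.contMDiff_zeroSection ℝ _

theorem SmoothForm.sub (hα : SmoothForm α) (hβ : SmoothForm β) : SmoothForm (α - β) :=
  ContMDiff.sub_section hα hβ

theorem SmoothField.mlieBracket (hX : SmoothField X) (hY : SmoothField Y) :
    SmoothField (VectorField.mlieBracket (𝓡 3) X Y) :=
  contMDiff_mlieBracket hX hY

theorem SmoothField.contMDiff_dirDeriv (hX : SmoothField X) {f : M → ℝ} (hf : SmoothFunction f) :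
    SmoothFunction (dirDeriv X f) :=
  contMDiff_mvfderiv_apply hf hX le_rfl

theorem SmoothField.leibniz_identity_mlieBracket (hX : SmoothField X) (hY : SmoothField Y)
    (hZ : SmoothField Z) (x : M) :
    VectorField.mlieBracket (𝓡 3) X (VectorField.mlieBracket (𝓡 3) Y Z) x =
      VectorField.mlieBracket (𝓡 3) (VectorField.mlieBracket (𝓡 3) X Y) Z x +
        VectorField.mlieBracket (𝓡 3) Y (VectorField.mlieBracket (𝓡 3) X Z) x :=
  VectorField.leibniz_identity_mlieBracket_apply ((hX x).of_le ENat.LEInfty.out)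
    ((hY x).of_le ENat.LEInfty.out) ((hZ x).of_le ENat.LEInfty.out)

end SmoothSections

namespace Coframe

section Frame

variable (e : Coframe M) {X Y : VField M} {f : M → ℝ}

theorem sum_form_smul_frame (x : M) (v : TangentSpace (𝓡 3) x) :
    ∑ a, e.form a x v • e.frame a x = v := by
  apply (e.bijective_pi x).1
  ext b
  simp [form_frame]

theorem smoothField_iff : SmoothField X ↔ ∀ a, SmoothFunction (fun y => e.form a y (X y)) := by
  refine ⟨fun hX a => (e.smooth a).contMDiff_apply hX, fun h x => ?_⟩
  have : FiniteDimensional ℝ (TangentSpace (𝓡 3) x) :=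
    inferInstanceAs (FiniteDimensional ℝ (EuclideanSpace ℝ (Fin 3)))
  have : T2Space (TangentSpace (𝓡 3) x) := inferInstanceAs (T2Space (EuclideanSpace ℝ (Fin 3)))
  exact contMDiffAt_section_of_coframe (fun a => e.smooth a x)
    ⟨(e.coordEquiv x).toContinuousLinearEquiv, rfl⟩ fun a => h a x

theorem smooth_frame (a : Fin 3) : SmoothField (e.frame a) := by
  simpa only [e.smoothField_iff, form_frame] using fun _ => contMDiff_const

theorem dirDeriv_eq_sum (X : VField M) (f : M → ℝ) (x : M) :
    dirDeriv X f x = ∑ a, e.form a x (X x) * dirDeriv (e.frame a) f x := by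
  conv_lhs => rw [dirDeriv, ← e.sum_form_smul_frame x (X x)]
  simp [dirDeriv]

theorem dirDeriv_form_frame (X : VField M) (a b : Fin 3) (x : M) :
    dirDeriv X (fun y => e.form b y (e.frame a y)) x = 0 := by
  simp only [form_frame, dirDeriv_const]

include e in
theorem dirDeriv_mlieBracket (hX : SmoothField X) (hY : SmoothField Y) (hf : SmoothFunction f)
    (x : M) : dirDeriv (VectorField.mlieBracket (𝓡 3) X Y) f x =
      dirDeriv X (dirDeriv Y f) x - dirDeriv Y (dirDeriv X f) x := by
  have h := congrArg (e.form 0 x) (mvfderiv_mlieBracket_smul hX hY (e.smooth_frame 0) hf x)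
  simp only [map_smul, smul_eq_mul, form_frame, if_true, mul_one] at h
  exact h

theorem metric_frame (X : VField M) (a : Fin 3) :
    e.metric X (e.frame a) = fun y => e.form a y (X y) := by
  ext y
  simp [metric, form_frame]

theorem form_nabla_eq_koszul (X Y : VField M) (c : Fin 3) (x : M) :
    e.form c x (e.nabla X Y x) = e.koszul X Y (e.frame c) x := by
  simp [nabla, form_frame]

theorem apply_form (Θ : ShapeOperator M) (a : Fin 3) :
    e.apply Θ (e.form a) = fun x => Θ.tensor x (e.frame a x) := by
  ext x v
  simp [apply, sharp, form_frame]

end Frame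

end Coframe

section ExteriorDerivative

variable {X Y Z : VField M} {α β : OneForm M}

omit [IsManifold (𝓡 3) ∞ M] in
theorem extDerivForm_zero (X Y : VField M) (x : M) : extDerivForm (0 : OneForm M) X Y x = 0 := by
  simp [extDerivForm, dirDeriv_const]

theorem extDerivForm_sub (hα : SmoothForm α) (hβ : SmoothForm β) (hX : SmoothField X)
    (hY : SmoothField Y) (x : M) :
    extDerivForm (α - β) X Y x = extDerivForm α X Y x - extDerivForm β X Y x := by
  have hsub {W V : VField M} (hV : SmoothField V) :
      dirDeriv W (fun y => (α - β) y (V y)) x =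
        dirDeriv W (fun y => α y (V y)) x - dirDeriv W (fun y => β y (V y)) x :=
    dirDeriv_sub ((hα.contMDiff_apply hV).mdifferentiableAt x)
      ((hβ.contMDiff_apply hV).mdifferentiableAt x)
  rw [extDerivForm, hsub hX, hsub hY]
  simp only [extDerivForm, Pi.sub_apply, sub_apply]
  ring

omit [IsManifold (𝓡 3) ∞ M] in
theorem extDerivForm_swap (α : OneForm M) (X Y : VField M) (x : M) :
    extDerivForm α X Y x = - extDerivForm α Y X x := by
  rw [extDerivForm, extDerivForm, VectorField.mlieBracket_swap_apply, map_neg]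
  ring

theorem dirDeriv_extDerivForm (hα : SmoothForm α) (hX : SmoothField X) (hY : SmoothField Y)
    (Z : VField M) (x : M) :
    dirDeriv Z (extDerivForm α X Y) x =
      dirDeriv Z (dirDeriv X (fun y => α y (Y y))) x -
          dirDeriv Z (dirDeriv Y (fun y => α y (X y))) x -
        dirDeriv Z (fun y => α y (VectorField.mlieBracket (𝓡 3) X Y y)) x := by
  have hXY := hX.contMDiff_dirDeriv (hα.contMDiff_apply hY)
  have hYX := hY.contMDiff_dirDeriv (hα.contMDiff_apply hX)
  have hbracket := hα.contMDiff_apply (hX.mlieBracket hY)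
  rw [← dirDeriv_sub (hXY.mdifferentiableAt x) (hYX.mdifferentiableAt x),
    ← dirDeriv_sub (SmoothFunction.mdifferentiableAt (hXY.sub hYX) x)
      (hbracket.mdifferentiableAt x)]
  rfl

namespace Coframe

variable (e : Coframe M)
include e

theorem extDerivForm_of_isExactForm (hα : IsExactForm α) (hX : SmoothField X)
    (hY : SmoothField Y) (x : M) : extDerivForm α X Y x = 0 := by
  obtain ⟨f, hf, hfα⟩ := hα
  simp only [extDerivForm, ← hfα]
  exact sub_eq_zero.2 (e.dirDeriv_mlieBracket hX hY hf x).symm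

/-- The invariant formula for `d (d α)(X, Y, Z) = 0`. -/
theorem extDerivForm_extDerivForm (hα : SmoothForm α) (hX : SmoothField X) (hY : SmoothField Y)
    (hZ : SmoothField Z) (x : M) :
    dirDeriv X (extDerivForm α Y Z) x - dirDeriv Y (extDerivForm α X Z) x +
      dirDeriv Z (extDerivForm α X Y) x
      - extDerivForm α (VectorField.mlieBracket (𝓡 3) X Y) Z x
      + extDerivForm α (VectorField.mlieBracket (𝓡 3) X Z) Y x
      - extDerivForm α (VectorField.mlieBracket (𝓡 3) Y Z) X x = 0 := by
  have hjacobi := congrArg (α x) (hX.leibniz_identity_mlieBracket hY hZ x)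
  rw [VectorField.mlieBracket_swap_apply (V := X) (W := VectorField.mlieBracket (𝓡 3) Y Z),
    VectorField.mlieBracket_swap_apply (V := Y) (W := VectorField.mlieBracket (𝓡 3) X Z), map_add,
    map_neg, map_neg] at hjacobi
  rw [dirDeriv_extDerivForm hα hY hZ, dirDeriv_extDerivForm hα hX hZ,
    dirDeriv_extDerivForm hα hX hY, extDerivForm, extDerivForm, extDerivForm,
    e.dirDeriv_mlieBracket hX hY (hα.contMDiff_apply hZ),
    e.dirDeriv_mlieBracket hX hZ (hα.contMDiff_apply hY),
    e.dirDeriv_mlieBracket hY hZ (hα.contMDiff_apply hX)]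
  linear_combination -hjacobi

end Coframe

end ExteriorDerivative

theorem sum_sum_mul_eq_zero_of_symm_of_antisymm {ι R : Type*} [Fintype ι] [Ring R]
    [IsAddTorsionFree R] {S A : ι → ι → R} (hS : ∀ a b, S a b = S b a)
    (hA : ∀ a b, A a b = -A b a) : ∑ a, ∑ b, S a b * A a b = 0 := by
  rw [← self_eq_neg, ← Finset.sum_neg_distrib, Finset.sum_comm]
  refine Finset.sum_congr rfl fun a _ => ?_
  rw [← Finset.sum_neg_distrib]
  exact Finset.sum_congr rfl fun b _ => by rw [hS, hA, mul_neg]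

namespace Coframe

variable {e : Coframe M}

/-- The Levi-Civita connection forms of a coframe, characterized by Cartan's first structure
equation and antisymmetry. The indices are such that `∇ E_b = ∑_c Γ_bc ⊗ E_c`. -/
structure IsConnectionForm (e : Coframe M) (Γ : Fin 3 → Fin 3 → OneForm M) : Prop where
  smooth : ∀ b c, SmoothForm (Γ b c)
  antisymm : ∀ b c, Γ b c = -Γ c b
  extDeriv_eq : ∀ (c : Fin 3) (X Y : VField M), SmoothField X → SmoothField Y → ∀ x,
    extDerivForm (e.form c) X Y x = ∑ b, wedge (e.form b) (Γ b c) X Y x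

section Nabla

variable (e) {X Y : VField M}

theorem form_mlieBracket (X Y : VField M) (c : Fin 3) (x : M) :
    e.form c x (VectorField.mlieBracket (𝓡 3) X Y x) =
      dirDeriv X (fun y => e.form c y (Y y)) x - dirDeriv Y (fun y => e.form c y (X y)) x -
        extDerivForm (e.form c) X Y x := by
  rw [extDerivForm, sub_sub_cancel]

theorem dirDeriv_metric (Z : VField M) (hX : SmoothField X) (hY : SmoothField Y) (x : M) :
    dirDeriv Z (e.metric X Y) x =
      ∑ a, (e.form a x (X x) * dirDeriv Z (fun y => e.form a y (Y y)) x +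
        e.form a x (Y x) * dirDeriv Z (fun y => e.form a y (X y)) x) := by
  have hXa a := (e.smooth a).contMDiff_apply hX
  have hYa a := (e.smooth a).contMDiff_apply hY
  exact dirDeriv_sum_mul (fun a _ => (hXa a).mdifferentiableAt x) fun a _ =>
    (hYa a).mdifferentiableAt x

theorem two_mul_form_nabla (hX : SmoothField X) (hY : SmoothField Y) (c : Fin 3) (x : M) :
    2 * e.form c x (e.nabla X Y x) =
      2 * dirDeriv X (fun y => e.form c y (Y y)) x - extDerivForm (e.form c) X Y x +
        ∑ a, (e.form a x (Y x) * extDerivForm (e.form a) X (e.frame c) x +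
          e.form a x (X x) * extDerivForm (e.form a) Y (e.frame c) x) := by
  rw [form_nabla_eq_koszul, koszul, e.metric_frame, e.metric_frame, e.metric_frame,
    e.dirDeriv_metric _ hX hY]
  simp only [metric, form_mlieBracket, dirDeriv_form_frame, Fin.sum_univ_three]
  ring

end Nabla

namespace IsConnectionForm

variable {Γ : Fin 3 → Fin 3 → OneForm M} (hΓ : e.IsConnectionForm Γ) {X Y : VField M}
include hΓ

theorem antisymm_apply (b c : Fin 3) (x : M) (v : TangentSpace (𝓡 3) x) :
    Γ b c x v = -Γ c b x v := by
  rw [hΓ.antisymm b c]; rfl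

theorem form_nabla (hX : SmoothField X) (hY : SmoothField Y) (c : Fin 3) (x : M) :
    e.form c x (e.nabla X Y x) =
      dirDeriv X (fun y => e.form c y (Y y)) x + ∑ b, e.form b x (Y x) * Γ b c x (X x) := by
  have hcancel : ∑ a, ∑ b, (e.form a x (X x) * e.form b x (Y x) +
      e.form b x (X x) * e.form a x (Y x)) * Γ a b x (e.frame c x) = 0 :=
    sum_sum_mul_eq_zero_of_symm_of_antisymm (fun _ _ => add_comm _ _)
      fun a b => hΓ.antisymm_apply a b x _
  have h := e.two_mul_form_nabla hX hY c x
  simp only [hΓ.extDeriv_eq _ X _ hX (e.smooth_frame c),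
    hΓ.extDeriv_eq _ Y _ hY (e.smooth_frame c), hΓ.extDeriv_eq c X Y hX hY, wedge,
    Finset.sum_sub_distrib, form_frame, ite_mul, one_mul, zero_mul, Finset.sum_ite_eq',
    Finset.mem_univ, if_true, hΓ.antisymm_apply c] at h
  simp only [Fin.sum_univ_three] at h hcancel ⊢
  linear_combination (1 / 2) * h + (1 / 2) * hcancel

theorem smoothField_nabla (hX : SmoothField X) (hY : SmoothField Y) :
    SmoothField (e.nabla X Y) := by
  simp only [e.smoothField_iff, hΓ.form_nabla hX hY]
  exact fun c => (hX.contMDiff_dirDeriv ((e.smooth c).contMDiff_apply hY)).add <|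
    contMDiff_finsetSum fun b _ =>
      ((e.smooth b).contMDiff_apply hY).mul ((hΓ.smooth b c).contMDiff_apply hX)

theorem form_nabla_frame (hX : SmoothField X) (b c : Fin 3) (x : M) :
    e.form c x (e.nabla X (e.frame b) x) = Γ b c x (X x) := by
  simp [hΓ.form_nabla hX (e.smooth_frame b), form_frame, dirDeriv_const]

theorem nabla_sub_nabla (hX : SmoothField X) (hY : SmoothField Y) (x : M) :
    e.nabla X Y x - e.nabla Y X x = VectorField.mlieBracket (𝓡 3) X Y x := by
  apply (e.bijective_pi x).1
  ext c
  have h := hΓ.extDeriv_eq c X Y hX hY x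
  simp only [wedge, Finset.sum_sub_distrib] at h
  simp only [LinearMap.pi_apply, ContinuousLinearMap.coe_coe, map_sub, hΓ.form_nabla hX hY,
    hΓ.form_nabla hY hX, form_mlieBracket, h]
  ring

theorem form_riemann_frame (hX : SmoothField X) (hY : SmoothField Y) (b c : Fin 3) (x : M) :
    e.form c x (e.riemann X Y (e.frame b) x) =
      extDerivForm (Γ b c) X Y x + ∑ d, wedge (Γ d c) (Γ b d) X Y x := by
  have hE := e.smooth_frame b
  simp only [riemann, Pi.sub_apply, map_sub, hΓ.form_nabla hX (hΓ.smoothField_nabla hY hE),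
    hΓ.form_nabla hY (hΓ.smoothField_nabla hX hE), hΓ.form_nabla_frame hX, hΓ.form_nabla_frame hY,
    hΓ.form_nabla_frame (hX.mlieBracket hY), extDerivForm, wedge, Finset.sum_sub_distrib]
  simp only [mul_comm]
  ring

theorem scalarCurvature_eq_sum (x : M) :
    e.scalarCurvature x = ∑ b, ∑ a, (extDerivForm (Γ b a) (e.frame a) (e.frame b) x +
      ∑ d, wedge (Γ d a) (Γ b d) (e.frame a) (e.frame b) x) := by
  simp only [scalarCurvature, ricci, metric_frame,
    hΓ.form_riemann_frame (e.smooth_frame _) (e.smooth_frame _)]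

end IsConnectionForm

section Codazzi

variable (e) (Θ : ShapeOperator M)

/-- The defect `(∇_X Θ)(Y, Z) - (∇_Y Θ)(X, Z)` in the Codazzi equation for `Θ`. -/
noncomputable def codazzi (X Y Z : VField M) (x : M) : ℝ :=
  e.nablaTensor Θ X Y Z x - e.nablaTensor Θ Y X Z x

theorem smooth_apply_form (a : Fin 3) : SmoothForm (e.apply Θ (e.form a)) := by
  simpa only [apply_form] using Θ.smooth.smoothForm_apply (e.smooth_frame a)

theorem tensor_frame_left (a : Fin 3) (x : M) (v : TangentSpace (𝓡 3) x) :
    Θ.tensor x (e.frame a x) v = e.apply Θ (e.form a) x v := by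
  rw [apply_form]

theorem tensor_frame_right (a : Fin 3) (x : M) (v : TangentSpace (𝓡 3) x) :
    Θ.tensor x v (e.frame a x) = e.apply Θ (e.form a) x v := by
  rw [Θ.symm, tensor_frame_left]

theorem tensor_eq_sum (x : M) (v w : TangentSpace (𝓡 3) x) :
    Θ.tensor x v w = ∑ a, e.form a x v * e.apply Θ (e.form a) x w := by
  conv_lhs => rw [← e.sum_form_smul_frame x v]
  simp [tensor_frame_left]

theorem nablaTensor_symm (X Y Z : VField M) (x : M) :
    e.nablaTensor Θ X Y Z x = e.nablaTensor Θ X Z Y x := by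
  simp only [nablaTensor, Θ.symm _ (Z _), Θ.symm _ _ (Y _)]
  ring

end Codazzi

namespace IsConnectionForm

variable {Γ : Fin 3 → Fin 3 → OneForm M} (hΓ : e.IsConnectionForm Γ) (Θ : ShapeOperator M)
  {X Y Z : VField M}
include hΓ

theorem nablaTensor_frame (hX : SmoothField X) (Y : VField M) (a : Fin 3) (x : M) :
    e.nablaTensor Θ X Y (e.frame a) x =
      dirDeriv X (fun y => e.apply Θ (e.form a) y (Y y)) x -
        e.apply Θ (e.form a) x (e.nabla X Y x) -
        ∑ b, Γ a b x (X x) * e.apply Θ (e.form b) x (Y x) := by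
  rw [nablaTensor, Θ.symm x (Y x), e.tensor_eq_sum Θ x (e.nabla X (e.frame a) x)]
  simp only [tensor_frame_right, hΓ.form_nabla_frame hX]

theorem codazzi_frame (hX : SmoothField X) (hY : SmoothField Y) (a : Fin 3) (x : M) :
    e.codazzi Θ X Y (e.frame a) x = extDerivForm (e.apply Θ (e.form a)) X Y x -
      ∑ b, wedge (Γ a b) (e.apply Θ (e.form b)) X Y x := by
  simp only [codazzi, hΓ.nablaTensor_frame Θ hX, hΓ.nablaTensor_frame Θ hY, extDerivForm, wedge,
    ← hΓ.nabla_sub_nabla hX hY, map_sub, Finset.sum_sub_distrib]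
  ring

theorem dirDeriv_trace (hZ : SmoothField Z) (x : M) :
    dirDeriv Z (e.trace Θ) x = ∑ a, e.nablaTensor Θ Z (e.frame a) (e.frame a) x := by
  have hcancel :
      ∑ a, ∑ b, e.apply Θ (e.form b) x (e.frame a x) * Γ a b x (Z x) = 0 :=
    sum_sum_mul_eq_zero_of_symm_of_antisymm
      (fun a b => by rw [← tensor_frame_left, tensor_frame_right]) fun a b =>
        hΓ.antisymm_apply a b x _
  have hdiag (a : Fin 3) : e.apply Θ (e.form a) x (e.nabla Z (e.frame a) x) =
      ∑ b, Γ a b x (Z x) * e.apply Θ (e.form b) x (e.frame a x) := by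
    rw [← tensor_frame_right, tensor_eq_sum]
    exact Finset.sum_congr rfl fun b _ => by rw [hΓ.form_nabla_frame hZ]
  rw [show e.trace Θ = fun y => ∑ a, e.apply Θ (e.form a) y (e.frame a y) from
      funext fun y => by simp only [trace, tensor_frame_left],
    dirDeriv_sum fun a _ =>
      ((e.smooth_apply_form Θ a).contMDiff_apply (e.smooth_frame a)).mdifferentiableAt x]
  simp only [hΓ.nablaTensor_frame Θ hZ, hdiag, Finset.sum_sub_distrib, mul_comm (Γ _ _ _ _),
    hcancel, sub_zero]

theorem dirDeriv_trace_sub_div (hZ : SmoothField Z) (x : M) :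
    dirDeriv Z (e.trace Θ) x - e.div Θ Z x =
      ∑ a, e.codazzi Θ Z (e.frame a) (e.frame a) x := by
  simp only [hΓ.dirDeriv_trace Θ hZ, div, codazzi, Finset.sum_sub_distrib,
    e.nablaTensor_symm Θ _ _ Z]

theorem nablaTensor_eq_sum (hX : SmoothField X) (hY : SmoothField Y) (hZ : SmoothField Z) (x : M) :
    e.nablaTensor Θ X Y Z x = ∑ c, e.form c x (Z x) * e.nablaTensor Θ X Y (e.frame c) x := by
  have hZc c := (e.smooth c).contMDiff_apply hZ
  have hYc c := (e.smooth_apply_form Θ c).contMDiff_apply hY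
  have hleibniz : dirDeriv X (fun y => Θ.tensor y (Z y) (Y y)) x =
      ∑ c, (e.form c x (Z x) * dirDeriv X (fun y => e.apply Θ (e.form c) y (Y y)) x +
        e.apply Θ (e.form c) x (Y x) * dirDeriv X (fun y => e.form c y (Z y)) x) := by
    simp only [e.tensor_eq_sum Θ]
    exact dirDeriv_sum_mul (fun c _ => (hZc c).mdifferentiableAt x) fun c _ =>
      (hYc c).mdifferentiableAt x
  rw [nablaTensor_symm, nablaTensor, hleibniz, e.tensor_eq_sum Θ, e.tensor_eq_sum Θ]
  simp only [hΓ.nablaTensor_frame Θ hX, hΓ.form_nabla hX hZ, Fin.sum_univ_three]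
  ring

theorem div_eq_sum (hZ : SmoothField Z) (x : M) :
    e.div Θ Z x = ∑ c, e.form c x (Z x) * e.div Θ (e.frame c) x := by
  simp only [div, Finset.mul_sum]
  rw [Finset.sum_comm]
  exact Finset.sum_congr rfl fun a _ =>
    hΓ.nablaTensor_eq_sum Θ (e.smooth_frame a) (e.smooth_frame a) hZ x

theorem momentumConstraint_iff_codazzi :
    MomentumConstraint e Θ ↔
      ∀ c x, ∑ a, e.codazzi Θ (e.frame c) (e.frame a) (e.frame a) x = 0 := by
  simp only [← hΓ.dirDeriv_trace_sub_div Θ (e.smooth_frame _), sub_eq_zero]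
  refine ⟨fun h c => h _ (e.smooth_frame c), fun h Z hZ x => ?_⟩
  rw [dirDeriv_eq_sum, hΓ.div_eq_sum Θ hZ]
  exact Finset.sum_congr rfl fun c _ => by rw [h]

end IsConnectionForm

end Coframe

namespace IsParallelCauchyPair

variable {e : Coframe M} {Θ : ShapeOperator M} {X Y : VField M}

section ConnectionForm

variable (e Θ)

/-- The connection forms `Γ_bc = δ_c0 Θ(e_b) - δ_b0 Θ(e_c)` of a parallel Cauchy pair. -/
noncomputable def connectionForm (b c : Fin 3) : OneForm M :=
  (if c = 0 then e.apply Θ (e.form b) else 0) - if b = 0 then e.apply Θ (e.form c) else 0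

theorem smooth_ite_apply_form (p : Prop) [Decidable p] (b : Fin 3) :
    SmoothForm (if p then e.apply Θ (e.form b) else 0) := by
  split_ifs
  exacts [e.smooth_apply_form Θ b, SmoothForm.zero]

theorem connectionForm_apply (b c : Fin 3) (x : M) (v : TangentSpace (𝓡 3) x) :
    connectionForm e Θ b c x v =
      (if c = 0 then e.apply Θ (e.form b) x v else 0) -
        if b = 0 then e.apply Θ (e.form c) x v else 0 := by
  simp only [connectionForm, Pi.sub_apply, sub_apply]
  split_ifs <;> rfl

theorem extDerivForm_connectionForm (hX : SmoothField X) (hY : SmoothField Y) (b c : Fin 3)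
    (x : M) :
    extDerivForm (connectionForm e Θ b c) X Y x =
      (if c = 0 then extDerivForm (e.apply Θ (e.form b)) X Y x else 0) -
        if b = 0 then extDerivForm (e.apply Θ (e.form c)) X Y x else 0 := by
  rw [connectionForm, extDerivForm_sub (smooth_ite_apply_form e Θ _ b)
    (smooth_ite_apply_form e Θ _ c) hX hY]
  split_ifs <;> simp only [extDerivForm_zero]

end ConnectionForm

variable (h : IsParallelCauchyPair e Θ)
include h

theorem isConnectionForm : e.IsConnectionForm (connectionForm e Θ) where
  smooth b c := (smooth_ite_apply_form e Θ _ b).sub (smooth_ite_apply_form e Θ _ c)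
  antisymm b c := (neg_sub _ _).symm
  extDeriv_eq c X Y hX hY x := by
    have hsymm : ∑ b, wedge (e.form b) (e.apply Θ (e.form b)) X Y x = 0 := by
      simp only [wedge, Finset.sum_sub_distrib, ← e.tensor_eq_sum, Θ.symm x (X x), sub_self]
    rw [h.extDeriv_eq c X Y hX hY]
    simp only [wedge, connectionForm_apply, Fin.sum_univ_three] at hsymm ⊢
    obtain rfl | hc := eq_or_ne c 0
    · simp only [↓reduceIte, Fin.reduceEq, one_ne_zero]
      linear_combination -hsymm
    · simp only [hc, ↓reduceIte, Fin.reduceEq, one_ne_zero]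
      ring

theorem codazzi_frame (hX : SmoothField X) (hY : SmoothField Y) (a : Fin 3) (x : M) :
    e.codazzi Θ X Y (e.frame a) x = extDerivForm (e.apply Θ (e.form a)) X Y x -
      wedge (e.apply Θ (e.form a)) (e.apply Θ (e.form 0)) X Y x := by
  rw [h.isConnectionForm.codazzi_frame Θ hX hY]
  simp only [wedge, connectionForm_apply, Fin.sum_univ_three]
  obtain rfl | ha := eq_or_ne a 0
  · simp only [↓reduceIte, Fin.reduceEq, one_ne_zero]
    ring
  · simp [ha]

theorem codazzi_frame_zero (hX : SmoothField X) (hY : SmoothField Y) (x : M) :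
    e.codazzi Θ X Y (e.frame 0) x = 0 := by
  rw [h.codazzi_frame hX hY, e.extDerivForm_of_isExactForm h.exact_apply hX hY, wedge]
  ring

/-- Evaluate `d(d e_a) = 0` on `E_0, E_i, E_j`. -/
theorem codazzi_frame_of_ne_zero {i j : Fin 3} (hi : i ≠ 0) (hj : j ≠ 0) (a : Fin 3) (x : M) :
    e.codazzi Θ (e.frame i) (e.frame j) (e.frame a) x = 0 := by
  have hE := e.smooth_frame
  have hd_ij (b : Fin 3) : extDerivForm (e.form b) (e.frame i) (e.frame j) = 0 := by
    ext y
    simp [h.extDeriv_eq b _ _ (hE i) (hE j), wedge, e.form_frame, hi.symm, hj.symm]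
  have hd_zero {k : Fin 3} (hk : k ≠ 0) (b : Fin 3) :
      extDerivForm (e.form b) (e.frame 0) (e.frame k) =
        fun y => -e.apply Θ (e.form b) y (e.frame k y) := by
    ext y
    simp [h.extDeriv_eq b _ _ (hE 0) (hE k), wedge, e.form_frame, hk.symm]
  have hbracket (b c d : Fin 3) :
      e.form d x (VectorField.mlieBracket (𝓡 3) (e.frame b) (e.frame c) x) =
        -extDerivForm (e.form d) (e.frame b) (e.frame c) x := by
    simp only [e.form_mlieBracket, e.dirDeriv_form_frame, sub_zero, zero_sub]
  have hbracket_ij : VectorField.mlieBracket (𝓡 3) (e.frame i) (e.frame j) x = 0 := by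
    rw [← e.sum_form_smul_frame x (VectorField.mlieBracket _ _ _ x)]
    simp [hbracket, hd_ij]
  have hdd := e.extDerivForm_extDerivForm (e.smooth a) (hE 0) (hE i) (hE j) x
  rw [h.extDeriv_eq a _ _ ((hE 0).mlieBracket (hE i)) (hE j),
    h.extDeriv_eq a _ _ ((hE 0).mlieBracket (hE j)) (hE i),
    h.extDeriv_eq a _ _ ((hE i).mlieBracket (hE j)) (hE 0), hd_ij, hd_zero hi, hd_zero hj] at hdd
  simp only [wedge, hbracket, hbracket_ij, hd_zero hi, hd_zero hj, e.form_frame, hi.symm,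
    hj.symm, Pi.zero_def, dirDeriv_const, dirDeriv_neg, map_zero, if_false, zero_mul, mul_zero,
    sub_zero] at hdd
  rw [h.codazzi_frame (hE i) (hE j), extDerivForm, hbracket_ij, map_zero, wedge]
  linear_combination hdd

theorem scalarCurvature_eq (x : M) :
    e.scalarCurvature x = e.normSq Θ x - e.trace Θ x ^ 2 +
      2 * ∑ a, e.codazzi Θ (e.frame 0) (e.frame a) (e.frame a) x := by
  have hexact := e.extDerivForm_of_isExactForm h.exact_apply (e.smooth_frame 0) (e.smooth_frame 0) x
  have hswap (a : Fin 3) : extDerivForm (e.apply Θ (e.form a)) (e.frame a) (e.frame 0) x =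
      -extDerivForm (e.apply Θ (e.form a)) (e.frame 0) (e.frame a) x := extDerivForm_swap _ _ _ _
  have hsymm (a b : Fin 3) : e.apply Θ (e.form b) x (e.frame a x) =
      e.apply Θ (e.form a) x (e.frame b x) := by
    rw [← e.tensor_frame_left, e.tensor_frame_right]
  simp only [h.isConnectionForm.scalarCurvature_eq_sum, Coframe.normSq, Coframe.trace,
    extDerivForm_connectionForm e Θ (e.smooth_frame _) (e.smooth_frame _),
    h.codazzi_frame (e.smooth_frame _) (e.smooth_frame _), wedge, connectionForm_apply,
    e.tensor_frame_left, Fin.sum_univ_three, hexact, hswap 1, hswap 2,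
    hsymm 1 0, hsymm 2 0, hsymm 2 1, ↓reduceIte, Fin.reduceEq, one_ne_zero]
  ring

theorem hamiltonianConstraint_iff_codazzi :
    HamiltonianConstraint e Θ ↔
      ∀ x, ∑ a, e.codazzi Θ (e.frame 0) (e.frame a) (e.frame a) x = 0 := by
  simp only [HamiltonianConstraint, h.scalarCurvature_eq, add_eq_left, mul_eq_zero,
    OfNat.ofNat_ne_zero, false_or]

theorem momentumConstraint_iff_codazzi :
    MomentumConstraint e Θ ↔
      ∀ x, ∑ a, e.codazzi Θ (e.frame 0) (e.frame a) (e.frame a) x = 0 := by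
  rw [h.isConnectionForm.momentumConstraint_iff_codazzi]
  refine ⟨fun hc => hc 0, fun h₀ c x => ?_⟩
  obtain rfl | hc := eq_or_ne c 0
  · exact h₀ x
  refine Finset.sum_eq_zero fun a _ => ?_
  obtain rfl | ha := eq_or_ne a 0
  · exact h.codazzi_frame_zero (e.smooth_frame c) (e.smooth_frame 0) x
  · exact h.codazzi_frame_of_ne_zero hc ha a x

end IsParallelCauchyPair

end ParallelCauchy

theorem mainTheorem8 {M : Type*} [TopologicalSpace M]
    [ChartedSpace (EuclideanSpace ℝ (Fin 3)) M] [IsManifold (𝓡 3) ∞ M]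
    (e : ParallelCauchy.Coframe M) (Θ : ParallelCauchy.ShapeOperator M)
    (h : ParallelCauchy.IsParallelCauchyPair e Θ) :
    ParallelCauchy.HamiltonianConstraint e Θ ↔ ParallelCauchy.MomentumConstraint e Θ := by
  rw [h.hamiltonianConstraint_iff_codazzi, h.momentumConstraint_iff_codazzi]
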